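/- **Theorem (Number of one-way communication channels).** Let $f:\{0,1\}^n\to\{0,1\}$ be a Boolean function. The *full-correlation box* of $f$ is the $n$-partite box in which party $i$ has input $x_i\in\{0,1\}$ and output $b_i\in\{0,1\}$, with $$P(b_1,\dots,b_n\mid x_1,\dots,x_n)=\begin{cases}\dfrac1{2^{n-1}} & \text{if } \sum_i b_i\equiv f(x_1,\dots,x_n)\pmod 2,\\[2mm] 0&\text{otherwise.}\end{cases}$$ Write $f$ in algebraic normal form, $$f(x_1,\dots,x_n)=\bigoplus_{I\subseteq\{1,\dots,n\}} a_I\cdot\bigwedge_{i\in I}x_i,\qquad a_I\in\{0,1\},$$ and let $\mathcal J=\{I : a_I=1,\ |I|\ge 2\}$. Let $n_{\mathcal J}$ be the maximal number of classes of a partition of $\mathcal J$ into nonempty classes such that $A\cap B=\emptyset$ whenever $A$ and $B$ lie in different classes. A one-way channel is an ordered pair $(i,j)$ of distinct parties; through it party $i$ can send messages (finite bit strings) to party $j$ as often as required. A set $E$ of one-way channels *suffices to simulate the box from scratch* if the parties, using only shared randomness independent of the inputs, local operations, and a finite-round protocol that communicates only through the channels in $E$, can produce outputs with exactly the conditional distribution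 $P$. Let $N^{\mathrm{scratch}}_{\mathrm{comm}}$ be the smallest cardinality of a set of channels that suffices to simulate the full-correlation box of $f$ from scratch. If $n_{\mathcal J}=1$, then the full-correlation box of $f$ can be simulated from scratch with finitely many channels, and $$N^{\mathrm{scratch}}_{\mathrm{comm}}=\Bigl|\bigcup_{I\in\mathcal J}I\Bigr|-1 .$$ -/

import Mathlib

/-- A bit. Addition in `ZMod 2` is XOR and multiplication is AND. -/
abbrev Bit : Type := ZMod 2

/-- An `n`-partite box with binary inputs and outputs: `P x b` is the probability `P(b | x)` of
the output tuple `b` given the input tuple `x`. -/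
abbrev Box (n : ℕ) : Type := (Fin n → Bit) → (Fin n → Bit) → ℝ

/-- The full-correlation box associated to the Boolean function `f`. -/
noncomputable def fullCorrelationBox {n : ℕ} (f : (Fin n → Bit) → Bit) : Box n :=
  fun x b => if ∑ i, b i = f x then 1 / 2 ^ (n - 1) else 0

/-- `f` is given by the algebraic normal form with coefficients `a`:
`f x` is the XOR over all `I` of `a I` times the AND of the `x i`, `i ∈ I`. -/
def IsANF {n : ℕ} (f : (Fin n → Bit) → Bit) (a : Finset (Fin n) → Bit) : Prop :=
  ∀ x, f x = ∑ I : Finset (Fin n), a I * ∏ i ∈ I, x i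

/-- The set `𝒥` of the nonlinear monomials: all `I` with `a I = 1` and `|I| ≥ 2`. -/
def nonlinearMonomials {n : ℕ} (a : Finset (Fin n) → Bit) : Finset (Finset (Fin n)) :=
  Finset.univ.filter fun I => a I = 1 ∧ 2 ≤ I.card

/-- A partition of `J` into (nonempty) classes such that members of different classes are
disjoint sets. -/
def IsSeparated {n : ℕ} {J : Finset (Finset (Fin n))} (P : Finpartition J) : Prop :=
  ∀ p ∈ P.parts, ∀ q ∈ P.parts, p ≠ q → ∀ A ∈ p, ∀ B ∈ q, Disjoint A B

/-- `n_𝒥`: the maximal number of classes of a separated partition of `J`. -/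
noncomputable def numComponents {n : ℕ} (J : Finset (Finset (Fin n))) : ℕ :=
  sSup {k | ∃ P : Finpartition J, IsSeparated P ∧ P.parts.card = k}

/-- The supremum in `numComponents` is a maximum. -/
theorem isGreatest_numComponents {n : ℕ} (J : Finset (Finset (Fin n))) :
    IsGreatest {k | ∃ P : Finpartition J, IsSeparated P ∧ P.parts.card = k}
      (numComponents J) := by
  have hb : BddAbove {k | ∃ P : Finpartition J, IsSeparated P ∧ P.parts.card = k} :=
    ⟨J.card, by rintro k ⟨P, -, rfl⟩; exact P.card_parts_le_card⟩
  refine ⟨Nat.sSup_mem ?_ hb, fun k hk => le_csSup hb hk⟩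
  rcases eq_or_ne J ∅ with rfl | h
  · refine ⟨_, Finpartition.empty _, ?_, rfl⟩
    intro p hp
    exact absurd hp (Finset.notMem_empty _)
  · refine ⟨_, Finpartition.indiscrete h, ?_, rfl⟩
    intro p hp q hq hpq
    exact absurd ((Finset.mem_singleton.1 hp).trans (Finset.mem_singleton.1 hq).symm) hpq

/-- A message: a bit string of any finite length (the empty string is silence). -/
abbrev Msg : Type := List Bool

/-- What a party has received so far: one entry for each past round, which lists the message
received from each party in that round. -/
abbrev View (n : ℕ) : Type := List (Fin n → Msg)

/-- A deterministic communication protocol of `n` parties, with finitely many synchronous rounds.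
In every round party `i` chooses, from its own input bit and its own view only, a message for each
party; at the end it chooses its output bit from its own input bit and its own view. -/
structure DetProtocol (n : ℕ) where
  rounds : ℕ
  send : Fin n → Bit → View n → Fin n → Msg
  out : Fin n → Bit → View n → Bit

namespace DetProtocol

variable {n : ℕ}

/-- `D.view E x t i` is the view of party `i` after `t` rounds on input `x`, where `E` is the set
of one-way channels: `(j, i) ∈ E` is a channel from `j` to `i`, usable in every round. Where there
is no channel, nothing gets through. -/
def view (D : DetProtocol n) (E : Finset (Fin n × Fin n)) (x : Fin n → Bit) :
    ℕ → Fin n → View n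
  | 0, _ => []
  | t + 1, i => D.view E x t i ++
      [fun j => if (j, i) ∈ E then D.send j (x j) (D.view E x t j) i else []]

/-- The output tuple of the protocol on input `x`. -/
def run (D : DetProtocol n) (E : Finset (Fin n × Fin n)) (x : Fin n → Bit) : Fin n → Bit :=
  fun i => D.out i (x i) (D.view E x D.rounds i)

end DetProtocol

/-- The box `P` can be simulated from scratch with the one-way channels `E`, i.e. by shared
randomness, local operations and communication through `E` only. The value `ω` of the shared
randomness is known to all parties from the start and is independent of the inputs, so it selects a
deterministic protocol (private randomness of the parties can be made part of `ω`). -/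
def SimulableFromScratch {n : ℕ} (E : Finset (Fin n × Fin n)) (P : Box n) : Prop :=
  ∃ (Ω : Type) (_ : MeasurableSpace Ω) (μ : MeasureTheory.Measure Ω)
    (_ : MeasureTheory.IsProbabilityMeasure μ) (D : Ω → DetProtocol n),
    ∀ x b : Fin n → Bit,
      MeasurableSet {ω | (D ω).run E x = b} ∧ μ.real {ω | (D ω).run E x = b} = P x b

/-- The numbers `k` such that `k` one-way channels, suitably placed between distinct parties,
suffice to simulate `P` from scratch. -/
def sufficientChannelNumbers {n : ℕ} (P : Box n) : Set ℕ :=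
  {k | ∃ E : Finset (Fin n × Fin n),
    (∀ e ∈ E, e.1 ≠ e.2) ∧ E.card = k ∧ SimulableFromScratch E P}

/-!
Write `U` for the union of the nonlinear monomials of `f`.

*Upper bound.* Fix a root `r ∈ U` and let every other party of `U` send its input to `r`. The root
then evaluates `f` at the input restricted to `U`. What is missing is the linear part of `f` outside
`U`, and each party outside `U` adds its own linear term locally, so the outputs have the right sum
(`restrict_add_linear`). Masking the outputs by shared uniform bits that sum to zero makes them
uniform among the tuples with that sum (`simulable_star`).

*Lower bound.* Let `C` be a set of parties such that no channel of `E` joins `C` to its complement.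
For a fixed value of the shared randomness, the outputs in `C` depend only on the inputs in `C`, and
likewise for the complement. As only finitely many inputs have to be served, some value of the
randomness computes `f` correctly on all of them, so `f` is a function of the inputs in `C` plus a
function of the others (`exists_split`). The coefficient of a monomial `I` is the sum of `f` over
the indicator vectors of subsets of `I` (`anf_coeff`), and for a split function that sum cancels in
pairs as soon as `I` meets both `C` and its complement (`coeff_eq_zero_of_split`). Hence no
nonlinear monomial crosses `C`. If `C` is moreover a connected component of the graph underlying
`E` and meets `U`, then `n_𝒥 = 1` forces `U ⊆ C` (`union_subset_of_no_crossing`), and a connected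
component has at most `|E| + 1` vertices (`card_supp_le`).
-/

open MeasureTheory

/-! ### Coefficients of the algebraic normal form -/

/-- Over `ZMod 2`, subsets of `I` with and without `j` cancel in pairs. -/
theorem sum_powerset_eq_zero {α : Type*} [DecidableEq α] {I : Finset α} {j : α} (hj : j ∈ I)
    {F : Finset α → Bit} (hF : ∀ K, j ∉ K → F (insert j K) = F K) :
    ∑ K ∈ I.powerset, F K = 0 := by
  rw [← Finset.insert_erase hj, Finset.sum_powerset_insert (Finset.notMem_erase j I),
    ← Finset.sum_add_distrib]
  refine Finset.sum_eq_zero fun K hK => ?_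
  rw [hF K fun h => Finset.notMem_erase j I (Finset.mem_powerset.1 hK h)]
  exact CharTwo.add_self_eq_zero _

/-- The input in which exactly the parties of `K` have input `1`. -/
def indicatorInput {n : ℕ} (K : Finset (Fin n)) : Fin n → Bit := fun i => if i ∈ K then 1 else 0

theorem prod_indicatorInput {n : ℕ} (L K : Finset (Fin n)) :
    ∏ i ∈ L, indicatorInput K i = if L ⊆ K then 1 else 0 := by
  simp only [indicatorInput]
  rw [Finset.prod_ite_zero]
  simp [Finset.subset_iff]

/-- Möbius inversion over `ZMod 2`. -/
theorem anf_coeff {n : ℕ} {f : (Fin n → Bit) → Bit} {a : Finset (Fin n) → Bit} (hf : IsANF f a)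
    (I : Finset (Fin n)) : a I = ∑ K ∈ I.powerset, f (indicatorInput K) := by
  have h1 : ∑ K ∈ I.powerset, f (indicatorInput K) =
      ∑ L : Finset (Fin n), a L * ∑ K ∈ I.powerset, (if L ⊆ K then 1 else 0) := by
    simp only [hf _, prod_indicatorInput, Finset.mul_sum]
    exact Finset.sum_comm
  rw [h1, Finset.sum_eq_single I]
  · have : ∀ K ∈ I.powerset, (if I ⊆ K then (1 : Bit) else 0) = if K = I then 1 else 0 := by
      intro K hK
      have := Finset.mem_powerset.1 hK
      congr 1
      exact propext ⟨fun h => this.antisymm h, fun h => h ▸ subset_rfl⟩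
    rw [Finset.sum_congr rfl this]
    simp
  · intro L _ hL
    by_cases hLI : L ⊆ I
    · obtain ⟨j, hjI, hjL⟩ := Finset.exists_of_ssubset (hLI.ssubset_of_ne hL)
      rw [sum_powerset_eq_zero hjI, mul_zero]
      intro K _
      simp only [Finset.subset_insert_iff_of_notMem hjL]
    · rw [Finset.sum_eq_zero, mul_zero]
      intro K hK
      rw [if_neg fun h => hLI (h.trans (Finset.mem_powerset.1 hK))]
  · simp

theorem coeff_eq_zero_of_split {n : ℕ} {f : (Fin n → Bit) → Bit} {a : Finset (Fin n) → Bit}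
    (hf : IsANF f a) {C : Set (Fin n)} {g h : (Fin n → Bit) → Bit}
    (hg : ∀ x y, (∀ i ∈ C, x i = y i) → g x = g y)
    (hh : ∀ x y, (∀ i ∉ C, x i = y i) → h x = h y) (hs : ∀ x, f x = g x + h x)
    {I : Finset (Fin n)} {i j : Fin n} (hi : i ∈ I) (hiC : i ∈ C) (hj : j ∈ I) (hjC : j ∉ C) :
    a I = 0 := by
  rw [anf_coeff hf I]
  simp only [hs, Finset.sum_add_distrib]
  rw [sum_powerset_eq_zero hj, sum_powerset_eq_zero hi, add_zero]
  · intro K _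
    refine hh _ _ fun k hk => ?_
    have : k ≠ i := fun h => hk (h ▸ hiC)
    simp [indicatorInput, this]
  · intro K _
    refine hg _ _ fun k hk => ?_
    have : k ≠ j := fun h => hjC (h ▸ hk)
    simp [indicatorInput, this]

/-! ### Connectedness of the set of nonlinear monomials -/

/-- Otherwise the monomials inside `C` and those outside `C` would be two separated classes. -/
theorem union_subset_of_no_crossing {n : ℕ} {J : Finset (Finset (Fin n))}
    (hJ : numComponents J = 1) {C : Set (Fin n)}
    (hC : ∀ I ∈ J, ∀ i ∈ I, ∀ j ∈ I, i ∈ C → j ∈ C)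
    {u : Fin n} (hu : u ∈ J.biUnion id) (huC : u ∈ C) {v : Fin n} (hv : v ∈ J.biUnion id) :
    v ∈ C := by
  classical
  by_contra hvC
  obtain ⟨A, hA, huA⟩ := Finset.mem_biUnion.1 hu
  obtain ⟨B, hB, hvB⟩ := Finset.mem_biUnion.1 hv
  have hAf : J.filter (fun I => ∃ i ∈ I, i ∈ C) ≠ ⊥ :=
    Finset.nonempty_iff_ne_empty.1 ⟨A, Finset.mem_filter.2 ⟨hA, u, huA, huC⟩⟩
  have hBf : J.filter (fun I => ¬ ∃ i ∈ I, i ∈ C) ≠ ⊥ :=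
    Finset.nonempty_iff_ne_empty.1 ⟨B, Finset.mem_filter.2 ⟨hB, by
      rintro ⟨i, hi, hiC⟩
      exact hvC (hC B hB i hi v hvB hiC)⟩⟩
  -- The monomials that meet `C` and those that do not form a separated partition in two classes.
  let P : Finpartition J := (Finpartition.indiscrete hAf).extend hBf
    (Finset.disjoint_filter_filter_not J J _)
    (Finset.filter_union_filter_not_eq _ J)
  have hcard : P.parts.card = 2 := by
    rw [Finpartition.card_extend, Finpartition.indiscrete_parts, Finset.card_singleton]
  have key : ∀ A ∈ J.filter (fun I => ∃ i ∈ I, i ∈ C),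
      ∀ B ∈ J.filter (fun I => ¬ ∃ i ∈ I, i ∈ C), Disjoint A B := by
    intro A hA B hB
    obtain ⟨hA, i, hi, hiC⟩ := Finset.mem_filter.1 hA
    exact Finset.disjoint_left.2 fun k hkA hkB =>
      (Finset.mem_filter.1 hB).2 ⟨k, hkB, hC A hA i hi k hkA hiC⟩
  have hsep : IsSeparated P := by
    intro p hp q hq hpq A hA B hB
    simp only [P, Finpartition.extend_parts, Finpartition.indiscrete_parts, Finset.mem_insert,
      Finset.mem_singleton] at hp hq
    rcases hp with rfl | rfl <;> rcases hq with rfl | rfl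
    · exact absurd rfl hpq
    · exact (key B hB A hA).symm
    · exact key A hA B hB
    · exact absurd rfl hpq
  have := (isGreatest_numComponents J).2 ⟨P, hsep, hcard⟩
  omega

/-! ### Locality of protocols -/

theorem DetProtocol.view_congr {n : ℕ} (D : DetProtocol n) {E : Finset (Fin n × Fin n)}
    {C : Set (Fin n)} (hC : ∀ i j, (j, i) ∈ E → i ∈ C → j ∈ C) {x y : Fin n → Bit}
    (hxy : ∀ i ∈ C, x i = y i) (t : ℕ) : ∀ i ∈ C, D.view E x t i = D.view E y t i := by
  induction t with
  | zero => intro i _; rfl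
  | succ t ih =>
    intro i hi
    simp only [DetProtocol.view, ih i hi]
    congr 2
    funext j
    split_ifs with h
    · rw [ih j (hC i j h hi), hxy j (hC i j h hi)]
    · rfl

theorem DetProtocol.run_congr {n : ℕ} (D : DetProtocol n) {E : Finset (Fin n × Fin n)}
    {C : Set (Fin n)} (hC : ∀ i j, (j, i) ∈ E → i ∈ C → j ∈ C) {x y : Fin n → Bit}
    (hxy : ∀ i ∈ C, x i = y i) : ∀ i ∈ C, D.run E x i = D.run E y i := by
  intro i hi
  simp only [DetProtocol.run, D.view_congr hC hxy _ i hi, hxy i hi]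

/-- A simulation of the box contains a deterministic protocol that is correct on every input. -/
theorem exists_sum_run_eq {n : ℕ} {f : (Fin n → Bit) → Bit} {E : Finset (Fin n × Fin n)}
    (h : SimulableFromScratch E (fullCorrelationBox f)) :
    ∃ D : DetProtocol n, ∀ x, ∑ i, D.run E x i = f x := by
  obtain ⟨Ω, _, μ, _, D, hD⟩ := h
  have hae : ∀ᵐ ω ∂μ, ∀ x b, ∑ i, b i ≠ f x → (D ω).run E x ≠ b := by
    rw [ae_all_iff]; intro x
    rw [ae_all_iff]; intro b
    rw [ae_all_iff]; intro hb
    have h0 : μ.real {ω | (D ω).run E x = b} = 0 := by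
      rw [(hD x b).2, fullCorrelationBox, if_neg hb]
    rw [measureReal_eq_zero_iff] at h0
    rw [ae_iff]
    simpa using h0
  obtain ⟨ω, hω⟩ := hae.exists
  refine ⟨D ω, fun x => ?_⟩
  by_contra hne
  exact hω x _ hne rfl

theorem exists_split {n : ℕ} {f : (Fin n → Bit) → Bit} {E : Finset (Fin n × Fin n)}
    (h : SimulableFromScratch E (fullCorrelationBox f)) {C : Set (Fin n)}
    (hC : ∀ i j, (j, i) ∈ E → (i ∈ C ↔ j ∈ C)) :
    ∃ g h : (Fin n → Bit) → Bit, (∀ x y, (∀ i ∈ C, x i = y i) → g x = g y) ∧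
      (∀ x y, (∀ i ∉ C, x i = y i) → h x = h y) ∧ ∀ x, f x = g x + h x := by
  classical
  obtain ⟨D, hD⟩ := exists_sum_run_eq h
  refine ⟨fun x => ∑ i with i ∈ C, D.run E x i, fun x => ∑ i with i ∉ C, D.run E x i,
    fun x y hxy => ?_, fun x y hxy => ?_, fun x => ?_⟩
  · exact Finset.sum_congr rfl fun i hi =>
      D.run_congr (fun i j hij => (hC i j hij).1) hxy i (Finset.mem_filter.1 hi).2
  · exact Finset.sum_congr rfl fun i hi =>
      D.run_congr (C := Cᶜ) (fun i j hij hi hj => hi ((hC i j hij).2 hj)) hxy i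
        (Finset.mem_filter.1 hi).2
  · rw [← hD x, Finset.sum_filter_add_sum_filter_not]

/-! ### Components of the channel graph -/

/-- The undirected graph underlying a set of one-way channels. -/
def channelGraph {n : ℕ} (E : Finset (Fin n × Fin n)) : SimpleGraph (Fin n) :=
  SimpleGraph.fromRel fun i j => (i, j) ∈ E

theorem card_edgeSet_channelGraph_le {n : ℕ} (E : Finset (Fin n × Fin n)) :
    Nat.card (channelGraph E).edgeSet ≤ E.card := by
  classical
  have hsub : (channelGraph E).edgeSet ⊆ ↑(E.image fun e => s(e.1, e.2)) := by
    intro e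
    induction e with | _ i j
    intro he
    rw [SimpleGraph.mem_edgeSet, channelGraph, SimpleGraph.fromRel_adj] at he
    rw [Finset.mem_coe, Finset.mem_image]
    rcases he.2 with h | h
    · exact ⟨_, h, rfl⟩
    · exact ⟨_, h, Sym2.eq_swap⟩
  calc Nat.card (channelGraph E).edgeSet
      ≤ Nat.card (↑(E.image fun e => s(e.1, e.2)) : Set (Sym2 (Fin n))) :=
        Nat.card_mono (Finset.finite_toSet _) hsub
    _ = (E.image fun e => s(e.1, e.2)).card := by simp
    _ ≤ E.card := Finset.card_image_le

theorem card_supp_le {n : ℕ} (E : Finset (Fin n × Fin n))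
    (c : (channelGraph E).ConnectedComponent) : Nat.card c.supp ≤ E.card + 1 := by
  have h1 := c.connected_toSimpleGraph.card_vert_le_card_edgeSet_add_one
  have h2 : Nat.card c.toSimpleGraph.edgeSet ≤ Nat.card (channelGraph E).edgeSet :=
    Nat.card_le_card_of_injective c.toSimpleGraph_hom.mapEdgeSet
      (SimpleGraph.Hom.mapEdgeSet.injective _ Subtype.val_injective)
  have h3 := card_edgeSet_channelGraph_le E
  exact h1.trans (by omega)

theorem card_union_le_of_simulable {n : ℕ} {f : (Fin n → Bit) → Bit} {a : Finset (Fin n) → Bit}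
    (hf : IsANF f a) (hJ : numComponents (nonlinearMonomials a) = 1)
    {E : Finset (Fin n × Fin n)} (hE : ∀ e ∈ E, e.1 ≠ e.2)
    (h : SimulableFromScratch E (fullCorrelationBox f)) :
    ((nonlinearMonomials a).biUnion id).card ≤ E.card + 1 := by
  rcases ((nonlinearMonomials a).biUnion id).eq_empty_or_nonempty with h0 | ⟨u, hu⟩
  · rw [h0]; simp
  set c := (channelGraph E).connectedComponentMk u
  have hclosed : ∀ i j, (j, i) ∈ E → (i ∈ c.supp ↔ j ∈ c.supp) := by
    intro i j hij
    have hadj : (channelGraph E).Adj i j := by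
      rw [channelGraph, SimpleGraph.fromRel_adj]
      exact ⟨(hE _ hij).symm, Or.inr hij⟩
    exact c.mem_supp_congr_adj hadj
  obtain ⟨g, k, hg, hk, hs⟩ := exists_split h hclosed
  have hcross : ∀ I ∈ nonlinearMonomials a, ∀ i ∈ I, ∀ j ∈ I, i ∈ c.supp → j ∈ c.supp := by
    intro I hI i hi j hj hic
    by_contra hjc
    have h0 := coeff_eq_zero_of_split hf hg hk hs hi hic hj hjc
    have h1 := (Finset.mem_filter.1 hI).2.1
    exact one_ne_zero (h1.symm.trans h0)
  have hsub : (↑((nonlinearMonomials a).biUnion id) : Set (Fin n)) ⊆ c.supp :=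
    fun v hv => union_subset_of_no_crossing hJ hcross hu rfl hv
  calc ((nonlinearMonomials a).biUnion id).card
      = Nat.card (↑((nonlinearMonomials a).biUnion id) : Set (Fin n)) := by
        rw [Nat.card_coe_set_eq, Set.ncard_coe_finset]
    _ ≤ Nat.card c.supp := Nat.card_mono (Set.toFinite _) hsub
    _ ≤ E.card + 1 := card_supp_le E c

/-! ### Simulation by a star of channels -/

/-- Outside the union of the nonlinear monomials, `f` is linear. -/
theorem restrict_add_linear {n : ℕ} {f : (Fin n → Bit) → Bit} {a : Finset (Fin n) → Bit}
    (hf : IsANF f a) (U : Finset (Fin n)) (hU : (nonlinearMonomials a).biUnion id ⊆ U)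
    (x : Fin n → Bit) :
    f (fun i => if i ∈ U then x i else 0) + ∑ i, (if i ∈ U then 0 else a {i} * x i) = f x := by
  classical
  rw [hf x, hf, ← eq_sub_iff_add_eq', ← Finset.sum_sub_distrib]
  refine Finset.sum_of_injOn (fun i => {i}) (fun i _ j _ h => Finset.singleton_injective h)
    (by simp) ?_ ?_
  · intro I _ hI
    rw [← mul_sub, Finset.prod_ite_zero]
    by_cases hIU : ∀ i ∈ I, i ∈ U
    · rw [if_pos hIU, sub_self, mul_zero]
    · have hcard : I.card < 2 ∨ a I = 0 := by
        by_contra! hc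
        have h1 : a I = 1 := Fin.eq_one_of_ne_zero _ hc.2
        exact hIU fun i hi => hU (Finset.mem_biUnion.2
          ⟨I, Finset.mem_filter.2 ⟨Finset.mem_univ _, h1, hc.1⟩, hi⟩)
      rcases hcard with hc | hc
      · exfalso
        push Not at hIU
        obtain ⟨i, hi, -⟩ := hIU
        obtain ⟨j, rfl⟩ := Finset.card_eq_one.1
          (le_antisymm (Nat.lt_succ_iff.1 hc) (Finset.card_pos.2 ⟨i, hi⟩))
        exact hI ⟨j, by simp, rfl⟩
      · rw [hc, zero_mul]
  · intro i _
    by_cases hi : i ∈ U <;> simp [hi]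

/-- The channels from the other parties of `U` to `r`. -/
def starChannels {n : ℕ} (U : Finset (Fin n)) (r : Fin n) : Finset (Fin n × Fin n) :=
  (U.erase r).image fun i => (i, r)

/-- One round, in which every party sends its input to every party; input `1` is sent as a
nonempty message and input `0` as silence, so that a missing channel reads as input `0`. The root
`r` evaluates `f` at what it knows, party `i ≠ r` outputs its local term `l i (x i)`, and all
outputs are masked by shared bits `ω`, the mask of `r` being the sum of the others. -/
def starProtocol {n : ℕ} (f : (Fin n → Bit) → Bit) (l : Fin n → Bit → Bit) (r : Fin n)
    (ω : {i : Fin n // i ≠ r} → Bit) : DetProtocol n where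
  rounds := 1
  send _ b _ _ := if b = 1 then [true] else []
  out i b v :=
    if h : i = r then
      f (fun j => if j = r then b else if (v.headD fun _ => []) j = [true] then 1 else 0) + ∑ k, ω k
    else l i b + ω ⟨i, h⟩

theorem starProtocol_run {n : ℕ} (f : (Fin n → Bit) → Bit) (l : Fin n → Bit → Bit)
    {U : Finset (Fin n)} {r : Fin n} (hr : r ∈ U) (ω : {i : Fin n // i ≠ r} → Bit)
    (x : Fin n → Bit) (i : Fin n) :
    (starProtocol f l r ω).run (starChannels U r) x i =
      if h : i = r then f (fun j => if j ∈ U then x j else 0) + ∑ k, ω k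
      else l i (x i) + ω ⟨i, h⟩ := by
  have hx : ∀ b : Bit, b = 0 ∨ b = 1 := by decide
  by_cases h : i = r
  · subst h
    simp only [DetProtocol.run, starProtocol, DetProtocol.view, dif_pos, List.nil_append,
      List.headD_cons]
    congr 2
    funext j
    by_cases hj : j = i
    · simp [hj, hr]
    · by_cases hjU : j ∈ U
      · rcases hx (x j) with h0 | h0 <;> simp [starChannels, hj, hjU, h0]
      · simp [starChannels, hj, hjU]
  · simp [DetProtocol.run, starProtocol, h]

theorem simulable_star {n : ℕ} {f : (Fin n → Bit) → Bit} {a : Finset (Fin n) → Bit}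
    (hf : IsANF f a) {U : Finset (Fin n)} (hU : (nonlinearMonomials a).biUnion id ⊆ U)
    {r : Fin n} (hr : r ∈ U) : SimulableFromScratch (starChannels U r) (fullCorrelationBox f) := by
  classical
  let l : Fin n → Bit → Bit := fun i b => if i ∈ U then 0 else a {i} * b
  let _ : MeasurableSpace ({i : Fin n // i ≠ r} → Bit) := ⊤
  refine ⟨{i : Fin n // i ≠ r} → Bit, ⊤, (PMF.uniformOfFintype _).toMeasure,
    PMF.toMeasure.isProbabilityMeasure _, starProtocol f l r, fun x b => ⟨trivial, ?_⟩⟩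
  have hsum : f (fun j => if j ∈ U then x j else 0) + ∑ k : {i : Fin n // i ≠ r}, l k (x k)
      = f x := by
    rw [← restrict_add_linear hf U hU x, Fintype.sum_eq_add_sum_subtype_ne _ r, if_pos hr, zero_add]
  have hb : ∑ i, b i = b r + ∑ k : {i : Fin n // i ≠ r}, b k :=
    Fintype.sum_eq_add_sum_subtype_ne _ r
  -- The outputs of the parties other than `r` determine the mask.
  have hiff : ∀ ω, (starProtocol f l r ω).run (starChannels U r) x = b ↔
      ω = (fun k : {i : Fin n // i ≠ r} => b k - l k (x k)) ∧ ∑ i, b i = f x := by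
    intro ω
    have hne : (∀ k : {i : Fin n // i ≠ r}, l k (x k) + ω k = b k) ↔
        ω = fun k : {i : Fin n // i ≠ r} => b k - l k (x k) := by
      rw [funext_iff]
      exact forall_congr' fun k => eq_sub_iff_add_eq'.symm
    have hrun : (starProtocol f l r ω).run (starChannels U r) x = b ↔
        (∀ k : {i : Fin n // i ≠ r}, l k (x k) + ω k = b k) ∧
          f (fun j => if j ∈ U then x j else 0) + ∑ k, ω k = b r := by
      simp only [funext_iff, starProtocol_run f l hr]
      constructor
      · intro h
        exact ⟨fun k => by simpa [k.2] using h k, by simpa using h r⟩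
      · rintro ⟨h1, h2⟩ i
        by_cases hi : i = r
        · subst hi; simpa using h2
        · simpa [hi] using h1 ⟨i, hi⟩
    rw [hrun, hne]
    refine and_congr_right fun hω => ?_
    rw [hω, hb, ← hsum, Finset.sum_sub_distrib]
    have hbits : ∀ p q s t : Bit, p + (q - s) = t ↔ t + q = p + s := by decide
    exact hbits _ _ _ _
  simp only [hiff, fullCorrelationBox]
  split_ifs with h
  · simp only [h, and_true, Set.ofPred_eq_eq_singleton]
    rw [measureReal_def, PMF.toMeasure_apply_singleton _ _ MeasurableSpace.measurableSet_top, PMF.uniformOfFintype_apply]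
    simp [Fintype.card_subtype_compl]
  · simp [h]

/-! ### The minimal number of channels -/

theorem mainTheorem2 (n : ℕ) (f : (Fin n → Bit) → Bit) (a : Finset (Fin n) → Bit)
    (hf : IsANF f a) (hJ : numComponents (nonlinearMonomials a) = 1) :
    IsLeast (sufficientChannelNumbers (fullCorrelationBox f))
      (((nonlinearMonomials a).biUnion id).card - 1) := by
  constructor
  · -- As `n_𝒥 ≠ 0`, there is a nonlinear monomial, and it contains a party `r` to serve as root.
    obtain ⟨P, -, hP⟩ := (isGreatest_numComponents (nonlinearMonomials a)).1
    obtain ⟨p, hp⟩ := Finset.card_pos.1 (hP.trans hJ ▸ one_pos)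
    obtain ⟨I, hI⟩ := P.nonempty_of_mem_parts hp
    have hIJ : I ∈ nonlinearMonomials a := P.le hp hI
    have hIcard := (Finset.mem_filter.1 hIJ).2.2
    obtain ⟨r, hr⟩ := Finset.card_pos.1 (by omega : 0 < I.card)
    have hrU : r ∈ (nonlinearMonomials a).biUnion id := Finset.mem_biUnion.2 ⟨I, hIJ, hr⟩
    refine ⟨starChannels _ r, ?_, ?_, simulable_star hf subset_rfl hrU⟩
    · intro e he
      obtain ⟨i, hi, rfl⟩ := Finset.mem_image.1 he
      exact Finset.ne_of_mem_erase hi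
    · rw [starChannels, Finset.card_image_of_injective _ fun i j h => congrArg Prod.fst h,
        Finset.card_erase_of_mem hrU]
  · rintro k ⟨E, hE, rfl, hsim⟩
    have := card_union_le_of_simulable hf hJ hE hsim
    omega
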